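/- For positive integers $n,d$, let $A_2(n,d)$ be the maximum size of a set of binary words of length $n$ in which any two distinct words are at Hamming distance at least $d$, and for an integer $r\ge 0$ let $V(n,r)=\sum_{i=0}^{r}\binom{n}{i}$. For $x\in\mathbb{R}$ let $\lceil x\rceil^{+}$ be the smallest nonnegative integer $m$ with $m\ge x$, and for integers $0\le r\le n$ put $$ e(n,r)=\frac16\sum_{w=1}^{r}\binom{n}{w}\left(\left(\sum_{i=1}^{r}\ \sum_{j=\lceil (w+i-r)/2\rceil^{+}}^{\min\{w,i\}}\binom{w}{j}\binom{n-w}{i-j}\right)-1\right). $$ Let $n$ and $d$ be positive integers with $d\le n$. Let $\mathcal{G}_{\mathcal S}$ be the graph whose vertices are the words of $\mathbb{F}_2^n$ of Hamming weight between $1$ and $d-1$, two of them being adjacent if and only if their Hamming distance is between $1$ and $d-1$. Then $e(n,d-1)$ is one third of the number of edges of $\mathcal{G}_{\mathcal S}$, and $$ A_2(n,d)\ \ge\ \frac{2^n}{V(n,d-1)}\cdot\frac{\log_2 V(n,d-1)-\log_2\sqrt{e(n,d-1)}}{10}, $$ where for $d\in\{1,2\}$, the only cases in which $e(n,d-1)=0$,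 the undefined term $\log_2\sqrt{e(n,d-1)}$ is read as $0$. -/

import Mathlib

noncomputable section

/-- A set `C` of binary words of length `n` is a code of minimum distance (at least) `d`:
any two distinct codewords are at Hamming distance at least `d`. -/
def IsBinaryCode (n d : ℕ) (C : Finset (Fin n → ZMod 2)) : Prop :=
  ∀ u ∈ C, ∀ v ∈ C, u ≠ v → d ≤ hammingDist u v

/-- `A₂(n,d)`: the maximum size of a binary code of length `n` and minimum distance `d`.
The set of sizes is nonempty and bounded by `2 ^ n`, so the supremum is a maximum. -/
def A₂ (n d : ℕ) : ℕ :=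
  sSup {m : ℕ | ∃ C : Finset (Fin n → ZMod 2), IsBinaryCode n d C ∧ C.card = m}

/-- `V(n,r)`: the volume of a Hamming sphere of radius `r` in `𝔽₂ⁿ`. -/
def hammingVolume (n r : ℕ) : ℕ :=
  ∑ i ∈ Finset.range (r + 1), n.choose i

/-- The quantity `e(n,r)`. The lower limit `⌈x⌉₊` of the inner sum is the smallest nonnegative
integer `m` with `x ≤ m`. -/
def sphereEdgeThird (n r : ℕ) : ℝ :=
  (1 / 6 : ℝ) * ∑ w ∈ Finset.Icc 1 r, (n.choose w : ℝ) *
    ((∑ i ∈ Finset.Icc 1 r,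
        ∑ j ∈ Finset.Icc ⌈((w : ℝ) + (i : ℝ) - (r : ℝ)) / 2⌉₊ (min w i),
          (w.choose j : ℝ) * ((n - w).choose (i - j) : ℝ)) - 1)

/-- The Gilbert graph: vertex set `𝔽₂ⁿ`, with `u`, `v` adjacent iff `1 ≤ d(u,v) ≤ d - 1`. -/
def gilbertGraph (n d : ℕ) : SimpleGraph (Fin n → ZMod 2) where
  Adj u v := 1 ≤ hammingDist u v ∧ hammingDist u v ≤ d - 1
  symm := ⟨fun u v h => by rwa [hammingDist_comm v u]⟩
  loopless := ⟨fun u h => by simp at h⟩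

/-- The Hamming sphere graph: the subgraph of the Gilbert graph induced by the neighbourhood
of the zero word. -/
def sphereGraph (n d : ℕ) : SimpleGraph ((gilbertGraph n d).neighborSet 0) :=
  (gilbertGraph n d).induce ((gilbertGraph n d).neighborSet 0)

end

/-! Codes of minimum distance `d` are the independent sets of the Gilbert graph, which is
`D`-regular with `D + 1 = V(n,d-1)`. Its translation symmetry makes every neighbourhood span the
same number `t` of edges, and counting words by weight and overlap of supports gives `t = 3
e(n,d-1)`.

The bound on independent sets is a Shearer-type argument with the hard-core model: `I` is drawn with
weight `l ^ |I|`. For a vertex `v` put `X_v = D·1[v ∈ I] + |I ∩ N(v)|`; by regularity `∑ X_v =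
2D|I|`. Condition on the part of `I` outside the closed neighbourhood of `v`: what remains is `{v}`
or an independent subset of the set `H` of still available neighbours. If `H` is small, `v` itself
is likely to be chosen; if `H` is large, many neighbours are, because `H` spans few edges. The two
contributions balance in `hardCore_local` to a logarithmic lower bound independent of `H`. Averaging
gives `card_mul_le_of_indepSet_card_le`, and `mul_logb_le_of_indepSet_card_le` chooses the fugacity.
-/

namespace SimpleGraph

/-! ### The hard-core partition function and the local estimate. -/

variable {V : Type*} (G : SimpleGraph V)

open Classical in
/-- The independent sets of `G` contained in `S`. -/
noncomputable def indepSetsIn (S : Finset V) : Finset (Finset V) :=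
  S.powerset.filter fun A => G.IsIndepSet (A : Set V)

/-- The partition function of the hard-core model on `G[S]` at fugacity `l`. -/
noncomputable def hardCore (l : ℝ) (S : Finset V) : ℝ :=
  ∑ A ∈ G.indepSetsIn S, l ^ A.card

variable {G}

lemma mem_indepSetsIn {S A : Finset V} :
    A ∈ G.indepSetsIn S ↔ A ⊆ S ∧ ∀ a ∈ A, ∀ b ∈ A, ¬ G.Adj a b := by
  classical
  unfold indepSetsIn
  rw [Finset.mem_filter, Finset.mem_powerset]
  exact and_congr_right fun _ => ⟨fun h a ha b hb hab => h ha hb hab.ne hab,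
    fun h a ha b hb _ => h a ha b hb⟩

lemma hardCore_mono {l : ℝ} (hl : 0 ≤ l) {S T : Finset V} (h : S ⊆ T) :
    G.hardCore l S ≤ G.hardCore l T := by
  refine Finset.sum_le_sum_of_subset_of_nonneg ?_ fun _ _ _ => by positivity
  intro A hA
  rw [mem_indepSetsIn] at hA ⊢
  exact ⟨hA.1.trans h, hA.2⟩

lemma hardCore_empty (l : ℝ) : G.hardCore l ∅ = 1 := by
  have : G.indepSetsIn ∅ = {∅} := by
    ext A
    rw [mem_indepSetsIn, Finset.mem_singleton, Finset.subset_empty]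
    exact ⟨fun h => h.1, fun h => by subst h; simp⟩
  simp [hardCore, this]

lemma one_le_hardCore {l : ℝ} (hl : 0 ≤ l) (S : Finset V) : 1 ≤ G.hardCore l S := by
  rw [← hardCore_empty (G := G) l]
  exact hardCore_mono hl (Finset.empty_subset S)

variable [DecidableEq V]

lemma sum_card_inter_mul (l : ℝ) (𝒜 : Finset (Finset V)) (S : Finset V) :
    ∑ A ∈ 𝒜, l ^ A.card * ((A ∩ S).card : ℝ) =
      ∑ u ∈ S, ∑ A ∈ 𝒜.filter (u ∈ ·), l ^ A.card := by
  simp_rw [Finset.sum_filter]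
  rw [Finset.sum_comm]
  refine Finset.sum_congr rfl fun A _ => ?_
  rw [← Finset.sum_filter, Finset.sum_const, nsmul_eq_mul, mul_comm, Finset.filter_mem_eq_inter,
    Finset.inter_comm]

variable [DecidableRel G.Adj]

/-- Deleting `u` leaves an arbitrary independent set avoiding the closed neighbourhood of `u`.
Divided by the partition function of `S`, this is the probability that `u` is occupied. -/
lemma sum_indepSetsIn_mem (l : ℝ) {S : Finset V} {u : V} (hu : u ∈ S) :
    ∑ A ∈ (G.indepSetsIn S).filter (u ∈ ·), l ^ A.card =
      l * G.hardCore l (S.filter fun w => w ≠ u ∧ ¬ G.Adj u w) := by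
  rw [hardCore, Finset.mul_sum]
  refine Finset.sum_bij' (fun A _ => A.erase u) (fun A _ => insert u A) ?_ ?_ ?_ ?_ ?_
  · intro A hA
    simp only [Finset.mem_filter, mem_indepSetsIn] at hA ⊢
    obtain ⟨⟨hAS, hA⟩, huA⟩ := hA
    refine ⟨fun w hw => ?_, fun a ha b hb => hA a (Finset.mem_of_mem_erase ha) b
      (Finset.mem_of_mem_erase hb)⟩
    rw [Finset.mem_erase] at hw
    simp only [Finset.mem_filter]
    exact ⟨hAS hw.2, hw.1, hA u huA w hw.2⟩
  · intro A hA
    simp only [Finset.mem_filter, mem_indepSetsIn] at hA ⊢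
    obtain ⟨hAS, hA⟩ := hA
    have h1 : ∀ a ∈ A, ¬ G.Adj u a := fun a ha => (Finset.mem_filter.1 (hAS ha)).2.2
    refine ⟨⟨Finset.insert_subset hu fun a ha => (Finset.mem_filter.1 (hAS ha)).1, ?_⟩,
      Finset.mem_insert_self _ _⟩
    intro a ha b hb
    rw [Finset.mem_insert] at ha hb
    rcases ha with rfl | ha <;> rcases hb with rfl | hb
    · exact G.irrefl
    · exact h1 b hb
    · exact fun h => h1 a ha h.symm
    · exact hA a ha b hb
  · intro A hA
    exact Finset.insert_erase (Finset.mem_filter.1 hA).2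
  · intro A hA
    refine Finset.erase_insert fun h => ?_
    exact (Finset.mem_filter.1 ((mem_indepSetsIn.1 hA).1 h)).2.1 rfl
  · intro A hA
    rw [← pow_succ', Finset.card_erase_add_one (Finset.mem_filter.1 hA).2]

lemma hardCore_insert_le {l : ℝ} (hl : 0 ≤ l) (u : V) (S : Finset V) :
    G.hardCore l (insert u S) ≤ (1 + l) * G.hardCore l S := by
  by_cases hu : u ∈ S
  · rw [Finset.insert_eq_of_mem hu]
    nlinarith [one_le_hardCore (G := G) hl S]
  rw [hardCore, ← Finset.sum_filter_add_sum_filter_not _ (u ∈ ·),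
    sum_indepSetsIn_mem l (Finset.mem_insert_self u S), add_comm, add_mul, one_mul]
  refine add_le_add (le_of_eq ?_) (mul_le_mul_of_nonneg_left (hardCore_mono hl ?_) hl)
  · rw [hardCore]
    congr 1
    ext A
    simp only [Finset.mem_filter, mem_indepSetsIn]
    refine ⟨fun h => ⟨(Finset.subset_insert_iff_of_notMem h.2).1 h.1.1, h.1.2⟩,
      fun h => ⟨⟨h.1.trans (Finset.subset_insert _ _), h.2⟩, fun h' => hu (h.1 h')⟩⟩
  · intro w hw
    simp only [Finset.mem_filter, Finset.mem_insert] at hw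
    tauto

lemma hardCore_union_le {l : ℝ} (hl : 0 ≤ l) (R T : Finset V) :
    G.hardCore l (R ∪ T) ≤ (1 + l) ^ R.card * G.hardCore l T := by
  induction R using Finset.induction_on with
  | empty => simp
  | insert u R hu ih =>
    rw [Finset.insert_union, Finset.card_insert_of_notMem hu, pow_succ', mul_assoc]
    exact (hardCore_insert_le hl u _).trans (mul_le_mul_of_nonneg_left ih (by linarith))

lemma hardCore_le_exp {l : ℝ} (hl : 0 ≤ l) (S : Finset V) :
    G.hardCore l S ≤ Real.exp (l * S.card) := by
  have h := hardCore_union_le (G := G) hl S ∅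
  rw [Finset.union_empty, hardCore_empty, mul_one] at h
  refine h.trans ?_
  rw [mul_comm, Real.exp_nat_mul]
  exact pow_le_pow_left₀ (by linarith) (by linarith [Real.add_one_le_exp l]) _

/-- The mean size of a hard-core independent set of `G[S]`, in terms of the number of edges. -/
lemma le_sum_card_indepSetsIn {l : ℝ} (hl : 0 ≤ l) (S : Finset V) :
    G.hardCore l S * (l / (1 + l) *
        (S.card - l * ∑ u ∈ S, ((S.filter (G.Adj u)).card : ℝ))) ≤
      ∑ A ∈ G.indepSetsIn S, l ^ A.card * (A.card : ℝ) := by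
  have h0 : ∑ A ∈ G.indepSetsIn S, l ^ A.card * (A.card : ℝ) =
      ∑ A ∈ G.indepSetsIn S, l ^ A.card * ((A ∩ S).card : ℝ) :=
    Finset.sum_congr rfl fun A hA => by
      rw [Finset.inter_eq_left.2 (mem_indepSetsIn.1 hA).1]
  have h1 : (S.card : ℝ) = ∑ u ∈ S, (1 : ℝ) := by simp
  rw [h0, sum_card_inter_mul, h1, Finset.mul_sum, ← Finset.sum_sub_distrib, Finset.mul_sum,
    Finset.mul_sum]
  refine Finset.sum_le_sum fun u hu => ?_
  rw [sum_indepSetsIn_mem l hu]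
  set k := (S.filter (G.Adj u)).card
  set T := S.filter fun w => w ≠ u ∧ ¬ G.Adj u w
  -- `S` exceeds `T` by only `k + 1` vertices, each costing a factor at most `1 + l`, so `u` is
  -- occupied with probability at least `l / (1 + l) ^ (k + 1)`, which is at least `l (1 - l k) / (1
  -- + l)` by `hB`.
  have hS : S = insert u (S.filter (G.Adj u)) ∪ T := by
    ext w
    simp only [Finset.mem_union, Finset.mem_insert, Finset.mem_filter, T]
    by_cases hw : w = u
    · subst hw; tauto
    · tauto
  have hZ : G.hardCore l S ≤ (1 + l) ^ (k + 1) * G.hardCore l T := by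
    conv_lhs => rw [hS]
    refine (hardCore_union_le hl _ _).trans_eq ?_
    rw [Finset.card_insert_of_notMem (by simp)]
  have hT := one_le_hardCore (G := G) hl T
  have hZ1 := one_le_hardCore (G := G) hl S
  have hB : (1 - l * k) * (1 + l) ^ k ≤ 1 := by
    have h2 : (1 + l) ^ k ≤ Real.exp (l * k) := by
      rw [mul_comm, Real.exp_nat_mul]
      exact pow_le_pow_left₀ (by linarith) (by linarith [Real.add_one_le_exp l]) _
    have h3 : 1 - l * k ≤ Real.exp (-(l * k)) := by linarith [Real.add_one_le_exp (-(l * k))]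
    calc (1 - l * k) * (1 + l) ^ k ≤ Real.exp (-(l * k)) * (1 + l) ^ k :=
          mul_le_mul_of_nonneg_right h3 (by positivity)
      _ ≤ Real.exp (-(l * k)) * Real.exp (l * k) :=
          mul_le_mul_of_nonneg_left h2 (Real.exp_pos _).le
      _ = 1 := by rw [← Real.exp_add]; simp
  have hl1 : 0 < 1 + l := by linarith
  rw [show G.hardCore l S * (l / (1 + l) * (1 - l * k)) =
    l * (G.hardCore l S * (1 - l * k) / (1 + l)) by ring]
  refine mul_le_mul_of_nonneg_left ?_ hl
  rw [div_le_iff₀ hl1]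
  rcases le_or_gt (1 - l * k) 0 with hneg | hpos
  · exact (mul_nonpos_of_nonneg_of_nonpos (by linarith) hneg).trans (by positivity)
  · calc G.hardCore l S * (1 - l * k)
        ≤ (1 + l) ^ (k + 1) * G.hardCore l T * (1 - l * k) :=
          mul_le_mul_of_nonneg_right hZ hpos.le
      _ = ((1 - l * k) * (1 + l) ^ k) * (G.hardCore l T * (1 + l)) := by ring
      _ ≤ 1 * (G.hardCore l T * (1 + l)) := mul_le_mul_of_nonneg_right hB (by positivity)
      _ = _ := one_mul _

/-- The local estimate behind the lower bound on the independence number. -/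
lemma hardCore_local {l K c B : ℝ} (hl : 0 ≤ l) (hK : 0 < K) (S : Finset V)
    (hc : l ^ 2 * ∑ u ∈ S, ((S.filter (G.Adj u)).card : ℝ) ≤ c)
    (hB0 : 0 ≤ B) (hB : B * (1 + l) ^ 2 ≤ 1 + Real.log K - c) :
    B * (l + G.hardCore l S) ≤
      K + ∑ A ∈ G.indepSetsIn S, l ^ A.card * (A.card : ℝ) := by
  have hl1 : 0 < 1 + l := by linarith
  set Z := G.hardCore l S with hZ
  have hZ1 : 1 ≤ Z := one_le_hardCore hl S
  have hZ0 : 0 < Z := by linarith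
  set y := l * S.card with hy
  -- Since `Z ≤ exp y`, the contribution of `v` decreases in `y` at slope at most one, while that of
  -- the neighbours in `hS1` grows like `y`; `y` cancels in the sum.
  have hKZ : 1 + Real.log K - y ≤ K / Z := by
    calc 1 + Real.log K - y ≤ Real.exp (Real.log K - y) := by
          linarith [Real.add_one_le_exp (Real.log K - y)]
      _ = K / Real.exp y := by rw [Real.exp_sub, Real.exp_log hK]
      _ ≤ K / Z := div_le_div_of_nonneg_left hK.le hZ0 (hardCore_le_exp hl S)
  have hKZ' : Z * (1 + Real.log K - y) ≤ K := by
    rw [le_div_iff₀ hZ0] at hKZ; linarith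
  have hS1 : Z * ((y - c) / (1 + l)) ≤
      ∑ A ∈ G.indepSetsIn S, l ^ A.card * (A.card : ℝ) := by
    refine le_trans (mul_le_mul_of_nonneg_left ?_ hZ0.le) (le_sum_card_indepSetsIn hl S)
    rw [div_mul_eq_mul_div]
    refine div_le_div_of_nonneg_right ?_ hl1.le
    rw [mul_sub, ← mul_assoc l l, ← sq]
    linarith
  have hK' : Z * (1 + Real.log K - y) / (1 + l) ≤ K := by
    rw [div_le_iff₀ hl1]; nlinarith
  -- One factor `1 + l` pays for `l + Z ≤ (1 + l) Z`, which uses `Z ≥ 1`; the other is the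
  -- denominator in `hS1`.
  calc B * (l + Z) ≤ B * ((1 + l) * Z) := mul_le_mul_of_nonneg_left (by nlinarith) hB0
    _ = Z * (B * (1 + l) ^ 2) / (1 + l) := by field_simp
    _ ≤ Z * (1 + Real.log K - c) / (1 + l) :=
        div_le_div_of_nonneg_right (mul_le_mul_of_nonneg_left hB hZ0.le) hl1.le
    _ = Z * (1 + Real.log K - y) / (1 + l) + Z * ((y - c) / (1 + l)) := by ring
    _ ≤ _ := add_le_add hK' hS1

end SimpleGraph

/-! ### Independent sets in regular graphs with sparse neighbourhoods. -/

namespace SimpleGraph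

variable {V : Type*} [Fintype V] [DecidableEq V] {G : SimpleGraph V} [DecidableRel G.Adj]

/-- The independent sets with a prescribed part `J` outside the closed neighbourhood of `v`:
`v` itself, or an independent set of neighbours of `v` without neighbours in `J`. -/
lemma sum_indepSetsIn_fiber (v : V) {J : Finset V}
    (hJ : ∀ a ∈ J, ∀ b ∈ J, ¬ G.Adj a b) (hJv : Disjoint J (insert v (G.neighborFinset v)))
    (F : Finset V → ℝ) :
    ∑ I ∈ (G.indepSetsIn Finset.univ).filter (· \ insert v (G.neighborFinset v) = J), F I =
      F (J ∪ {v}) + ∑ A ∈ G.indepSetsIn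
        ((G.neighborFinset v).filter fun u => ∀ a ∈ J, ¬ G.Adj a u), F (J ∪ A) := by
  set N := G.neighborFinset v with hN
  set H := N.filter fun u => ∀ a ∈ J, ¬ G.Adj a u with hH
  have hNv : ∀ {u}, u ∈ N ↔ G.Adj v u := by simp [hN]
  have hvJ : v ∉ J := fun h => Finset.disjoint_left.1 hJv h (Finset.mem_insert_self _ _)
  have hNJ : ∀ u ∈ N, u ∉ J := fun u hu h =>
    Finset.disjoint_left.1 hJv h (Finset.mem_insert_of_mem hu)
  have hHN : H ⊆ N := Finset.filter_subset _ _
  have hvN : v ∉ N := by simp [hN]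
  have key : (G.indepSetsIn Finset.univ).filter (· \ insert v N = J) =
      insert (J ∪ {v}) ((G.indepSetsIn H).image (J ∪ ·)) := by
    ext I
    simp only [Finset.mem_filter, Finset.mem_insert, Finset.mem_image, mem_indepSetsIn,
      Finset.subset_univ, true_and]
    constructor
    · rintro ⟨hI, rfl⟩
      by_cases hv : v ∈ I
      · left
        ext u
        simp only [Finset.mem_union, Finset.mem_sdiff, Finset.mem_insert, Finset.mem_singleton]
        by_cases huv : u = v
        · simp [huv, hv]
        · have : u ∈ I → u ∉ N := fun hu h => hI v hv u hu (hNv.1 h)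
          tauto
      · right
        refine ⟨I ∩ N, ⟨fun u hu => ?_, fun a ha b hb => hI a (Finset.mem_inter.1 ha).1 b
          (Finset.mem_inter.1 hb).1⟩, ?_⟩
        · rw [Finset.mem_inter] at hu
          exact Finset.mem_filter.2 ⟨hu.2, fun a ha => hI a (Finset.mem_sdiff.1 ha).1 u hu.1⟩
        · ext u
          simp only [Finset.mem_union, Finset.mem_sdiff, Finset.mem_insert, Finset.mem_inter]
          by_cases huv : u = v
          · subst huv; tauto
          · tauto
    · rintro (rfl | ⟨A, ⟨hAH, hA⟩, rfl⟩)
      · have hvJ' : ∀ a ∈ J, ¬ G.Adj v a := fun a ha h => hNJ a (hNv.2 h) ha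
        refine ⟨?_, ?_⟩
        · intro a ha b hb
          rw [Finset.mem_union, Finset.mem_singleton] at ha hb
          rcases ha with ha | rfl <;> rcases hb with hb | rfl
          · exact hJ a ha b hb
          · exact fun h => hvJ' a ha h.symm
          · exact hvJ' b hb
          · exact G.irrefl
        · rw [Finset.union_sdiff_distrib, Finset.sdiff_eq_self_of_disjoint hJv,
            Finset.sdiff_eq_empty_iff_subset.2 (by simp), Finset.union_empty]
      · refine ⟨?_, ?_⟩
        · intro a ha b hb
          rw [Finset.mem_union] at ha hb
          rcases ha with ha | ha <;> rcases hb with hb | hb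
          · exact hJ a ha b hb
          · exact (Finset.mem_filter.1 (hAH hb)).2 a ha
          · exact fun h => (Finset.mem_filter.1 (hAH ha)).2 b hb h.symm
          · exact hA a ha b hb
        · rw [Finset.union_sdiff_distrib, Finset.sdiff_eq_self_of_disjoint hJv,
            Finset.sdiff_eq_empty_iff_subset.2
              ((hAH.trans hHN).trans (Finset.subset_insert _ _)), Finset.union_empty]
  rw [key, Finset.sum_insert, Finset.sum_image]
  · intro A hA B hB hAB
    have hA' := (mem_indepSetsIn.1 (Finset.mem_coe.1 hA)).1.trans hHN
    have hB' := (mem_indepSetsIn.1 (Finset.mem_coe.1 hB)).1.trans hHN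
    have hd : ∀ C ⊆ N, (J ∪ C) \ J = C := fun C hC => by
      rw [Finset.union_sdiff_left]
      exact Finset.sdiff_eq_self_of_disjoint
        (Finset.disjoint_left.2 fun u hu => hNJ u (hC hu))
    have hAB' : J ∪ A = J ∪ B := hAB
    rw [← hd A hA', ← hd B hB', hAB']
  · intro h
    obtain ⟨A, hA, hAv⟩ := Finset.mem_image.1 h
    have : v ∈ J ∪ A := by simp [hAv]
    rcases Finset.mem_union.1 this with h | h
    · exact hvJ h
    · exact hvN (hHN ((mem_indepSetsIn.1 hA).1 h))

/-- In probabilistic terms `X_v` has mean at least `B`. It suffices to prove this for each fixed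
outside part `J`, where it is `hardCore_local` with `K = l * D`, scaled by `l ^ J.card`. -/
lemma hardCore_mul_le_sum {l c B : ℝ} {D : ℕ} (hl : 0 < l) (hD : 0 < D) (v : V)
    (hc : l ^ 2 * ∑ u ∈ G.neighborFinset v,
      (((G.neighborFinset v).filter (G.Adj u)).card : ℝ) ≤ c)
    (hB0 : 0 ≤ B) (hB : B * (1 + l) ^ 2 ≤ 1 + Real.log (l * D) - c) :
    B * G.hardCore l Finset.univ ≤ ∑ I ∈ G.indepSetsIn Finset.univ,
      l ^ I.card * ((if v ∈ I then (D : ℝ) else 0) + ((I ∩ G.neighborFinset v).card : ℝ)) := by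
  set N := G.neighborFinset v with hN
  have hvN : v ∉ N := by simp [hN]
  rw [hardCore, Finset.mul_sum]
  have hmap : ∀ I ∈ G.indepSetsIn Finset.univ,
      I \ insert v N ∈ G.indepSetsIn (Finset.univ \ insert v N) := fun I hI =>
    mem_indepSetsIn.2 ⟨Finset.sdiff_subset_sdiff (Finset.subset_univ _) subset_rfl,
      fun a ha b hb => (mem_indepSetsIn.1 hI).2 a (Finset.mem_sdiff.1 ha).1 b
        (Finset.mem_sdiff.1 hb).1⟩
  rw [← Finset.sum_fiberwise_of_maps_to hmap, ← Finset.sum_fiberwise_of_maps_to hmap]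
  refine Finset.sum_le_sum fun J hJ => ?_
  obtain ⟨hJs, hJ⟩ := mem_indepSetsIn.1 hJ
  have hJv : Disjoint J (insert v N) :=
    Finset.disjoint_left.2 fun u hu => (Finset.mem_sdiff.1 (hJs hu)).2
  rw [sum_indepSetsIn_fiber v hJ hJv, sum_indepSetsIn_fiber v hJ hJv]
  set H := N.filter fun u => ∀ a ∈ J, ¬ G.Adj a u with hH
  have hHN : H ⊆ N := Finset.filter_subset _ _
  have hJN : Disjoint J N := hJv.mono_right (Finset.subset_insert _ _)
  have hvJ : v ∉ J := fun h => Finset.disjoint_left.1 hJv h (Finset.mem_insert_self _ _)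
  -- Forbidding the neighbours of `J` only removes edges, so one bound `c` serves all fibres.
  have hcH : l ^ 2 * ∑ u ∈ H, ((H.filter (G.Adj u)).card : ℝ) ≤ c := by
    refine le_trans (mul_le_mul_of_nonneg_left ?_ (by positivity)) hc
    refine (Finset.sum_le_sum fun u _ => ?_).trans
      (Finset.sum_le_sum_of_subset_of_nonneg hHN fun _ _ _ => by positivity)
    exact_mod_cast Finset.card_le_card (Finset.filter_subset_filter _ hHN)
  have hloc := hardCore_local hl.le (mul_pos hl (Nat.cast_pos.2 hD)) H hcH hB0 hB
  have e1 : (J ∪ {v}).card = J.card + 1 := by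
    rw [Finset.card_union_of_disjoint (by simpa using hvJ), Finset.card_singleton]
  have e2 : ((J ∪ {v}) ∩ N) = ∅ := by
    rw [Finset.union_inter_distrib_right, Finset.disjoint_iff_inter_eq_empty.1 hJN,
      Finset.singleton_inter_of_notMem hvN, Finset.union_empty]
  have hA : ∀ A ∈ G.indepSetsIn H, (J ∪ A).card = J.card + A.card ∧ v ∉ J ∪ A ∧
      (J ∪ A) ∩ N = A := by
    intro A hA
    have hAN := (mem_indepSetsIn.1 hA).1.trans hHN
    refine ⟨Finset.card_union_of_disjoint (hJN.mono_right hAN), ?_, ?_⟩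
    · rw [Finset.mem_union]
      exact fun h => h.elim hvJ fun h => hvN (hAN h)
    · rw [Finset.union_inter_distrib_right, Finset.disjoint_iff_inter_eq_empty.1 hJN,
        Finset.empty_union, Finset.inter_eq_left.2 hAN]
  have s1 : ∑ A ∈ G.indepSetsIn H, B * l ^ (J ∪ A).card =
      l ^ J.card * (B * G.hardCore l H) := by
    rw [hardCore, Finset.mul_sum, Finset.mul_sum]
    refine Finset.sum_congr rfl fun A h => ?_
    rw [(hA A h).1, pow_add]; ring
  have s2 : ∑ A ∈ G.indepSetsIn H, l ^ (J ∪ A).card *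
      ((if v ∈ J ∪ A then (D : ℝ) else 0) + (((J ∪ A) ∩ N).card : ℝ)) =
      l ^ J.card * ∑ A ∈ G.indepSetsIn H, l ^ A.card * (A.card : ℝ) := by
    rw [Finset.mul_sum]
    refine Finset.sum_congr rfl fun A h => ?_
    rw [(hA A h).1, if_neg (hA A h).2.1, (hA A h).2.2, pow_add]; ring
  rw [s1, s2, e1, e2, if_pos (by simp), pow_succ]
  have := mul_le_mul_of_nonneg_left hloc (pow_pos hl J.card).le
  simp only [Finset.card_empty, Nat.cast_zero, add_zero]
  linarith

/-- A lower bound for the independence number of a regular graph whose neighbourhoods span few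
edges. -/
lemma card_mul_le_of_indepSet_card_le {l c B a : ℝ} {D : ℕ} (hreg : G.IsRegularOfDegree D)
    (hl : 0 < l) (hD : 0 < D)
    (hc : ∀ v, l ^ 2 * ∑ u ∈ G.neighborFinset v,
      (((G.neighborFinset v).filter (G.Adj u)).card : ℝ) ≤ c)
    (hB0 : 0 ≤ B) (hB : B * (1 + l) ^ 2 ≤ 1 + Real.log (l * D) - c)
    (ha : ∀ I ∈ G.indepSetsIn Finset.univ, (I.card : ℝ) ≤ a) :
    Fintype.card V * B ≤ 2 * D * a := by
  have hZ := one_le_hardCore (G := G) hl.le Finset.univ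
  have hsum := Finset.sum_le_sum fun v (_ : v ∈ (Finset.univ : Finset V)) =>
    hardCore_mul_le_sum hl hD v (hc v) hB0 hB
  rw [Finset.sum_const, Finset.card_univ, nsmul_eq_mul, Finset.sum_comm] at hsum
  have hI : ∀ I ∈ G.indepSetsIn Finset.univ, ∑ v, l ^ I.card *
      ((if v ∈ I then (D : ℝ) else 0) + ((I ∩ G.neighborFinset v).card : ℝ)) ≤
      l ^ I.card * (2 * D * a) := by
    intro I hI
    rw [← Finset.mul_sum]
    refine mul_le_mul_of_nonneg_left ?_ (by positivity)
    have h1 : ∑ v, (if v ∈ I then (D : ℝ) else 0) = D * I.card := by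
      simp [mul_comm]
    have h2 : ∑ v, ((I ∩ G.neighborFinset v).card : ℝ) = D * I.card := by
      have h3 : ∀ v, ((I ∩ G.neighborFinset v).card : ℝ) =
          ∑ u ∈ I, if G.Adj v u then (1 : ℝ) else 0 := by
        intro v
        rw [← Finset.sum_filter, Finset.sum_const, nsmul_eq_mul, mul_one]
        congr 2
        ext u
        simp
      have h4 : ∀ u, (∑ v, if G.Adj v u then (1 : ℝ) else 0) = D := by
        intro u
        rw [← Finset.sum_filter, Finset.sum_const, nsmul_eq_mul, mul_one, ← hreg u,
          ← card_neighborFinset_eq_degree]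
        congr 2
        ext w
        simp [G.adj_comm]
      simp_rw [h3]
      rw [Finset.sum_comm]
      simp [h4, mul_comm]
    rw [Finset.sum_add_distrib, h1, h2]
    nlinarith [ha I hI, (Nat.cast_pos (α := ℝ)).2 hD]
  have hfin := hsum.trans (Finset.sum_le_sum hI)
  rw [← Finset.sum_mul] at hfin
  change _ ≤ G.hardCore l Finset.univ * _ at hfin
  refine le_of_mul_le_mul_left ?_ (by linarith : 0 < G.hardCore l Finset.univ)
  linarith

/-- The greedy bound: a maximal independent set dominates the graph. -/
lemma card_le_of_indepSet_card_le {D : ℕ} {a : ℝ} (hreg : G.IsRegularOfDegree D)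
    (ha : ∀ I ∈ G.indepSetsIn Finset.univ, (I.card : ℝ) ≤ a) :
    (Fintype.card V : ℝ) ≤ (D + 1) * a := by
  have hne : (G.indepSetsIn Finset.univ).Nonempty := ⟨∅, mem_indepSetsIn.2 (by simp)⟩
  obtain ⟨I, hI, hmax⟩ := Finset.exists_max_image _ Finset.card hne
  have hI' := (mem_indepSetsIn.1 hI).2
  have hcov : Finset.univ ⊆ I.biUnion fun u => insert u (G.neighborFinset u) := by
    intro v _
    by_contra hv
    simp only [Finset.mem_biUnion, Finset.mem_insert, mem_neighborFinset, not_exists, not_and,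
      not_or] at hv
    have hvI : v ∉ I := fun h => (hv v h).1 rfl
    have := hmax (insert v I) (mem_indepSetsIn.2 ⟨Finset.subset_univ _, ?_⟩)
    · rw [Finset.card_insert_of_notMem hvI] at this
      omega
    · intro a ha b hb
      rw [Finset.mem_insert] at ha hb
      rcases ha with rfl | ha <;> rcases hb with rfl | hb
      · exact G.irrefl
      · exact fun h => (hv b hb).2 h.symm
      · exact (hv a ha).2
      · exact hI' a ha b hb
  have h1 : Fintype.card V ≤ I.card * (D + 1) := by
    rw [← Finset.card_univ]
    refine (Finset.card_le_card hcov).trans (Finset.card_biUnion_le_card_mul _ _ _ fun u _ => ?_)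
    refine (Finset.card_insert_le _ _).trans ?_
    rw [card_neighborFinset_eq_degree, hreg u]
  have h2 : (Fintype.card V : ℝ) ≤ I.card * (D + 1) := by exact_mod_cast h1
  nlinarith [ha I hI, (Nat.cast_nonneg D : (0 : ℝ) ≤ D)]

/-- The independence number of a `D`-regular graph on `N` vertices in which every neighbourhood
spans at most `s` edges is at least `N / (D + 1) * (log₂ (D + 1) - log₂ √(s / 3)) / 10`. -/
theorem mul_logb_le_of_indepSet_card_le {D : ℕ} {s a : ℝ} (hreg : G.IsRegularOfDegree D)
    (hs : 1 ≤ s)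
    (hedge : ∀ v, ∑ u ∈ G.neighborFinset v,
      (((G.neighborFinset v).filter (G.Adj u)).card : ℝ) ≤ 2 * s)
    (ha : ∀ I ∈ G.indepSetsIn Finset.univ, (I.card : ℝ) ≤ a) :
    (Fintype.card V : ℝ) / ((D : ℝ) + 1) *
      ((Real.logb 2 ((D : ℝ) + 1) - Real.logb 2 (Real.sqrt (s / 3))) / 10) ≤ a := by
  set L := Real.logb 2 ((D : ℝ) + 1) - Real.logb 2 (Real.sqrt (s / 3)) with hL
  have hD1 : (0 : ℝ) < D + 1 := by positivity
  have hN0 : (0 : ℝ) ≤ Fintype.card V := Nat.cast_nonneg _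
  -- For `L ≤ 10` the factor `L / 10` is at most one and the greedy bound suffices; `L > 10` absorbs
  -- the additive constants below.
  rcases le_or_gt L 10 with hL10 | hL10
  · have hg := card_le_of_indepSet_card_le hreg ha
    calc (Fintype.card V : ℝ) / ((D : ℝ) + 1) * (L / 10)
        ≤ (Fintype.card V : ℝ) / ((D : ℝ) + 1) * 1 :=
          mul_le_mul_of_nonneg_left (by linarith) (by positivity)
      _ ≤ a := by rw [mul_one, div_le_iff₀ hD1]; linarith
  have hs0 : 0 < s := by linarith
  have hlog2 := Real.log_two_gt_d9
  have hlog2' := Real.log_two_lt_d9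
  have hLlog : L * Real.log 2 = Real.log (D + 1) - Real.log s / 2 + Real.log 3 / 2 := by
    rw [hL, Real.logb, Real.logb, ← sub_div, div_mul_cancel₀ _ (by linarith), Real.log_sqrt
      (by positivity), Real.log_div hs0.ne' (by norm_num)]
    ring
  have hlog3 : Real.log 3 ≤ 2 * Real.log 2 := by
    rw [show 2 * Real.log 2 = Real.log 4 by
      rw [show (4 : ℝ) = 2 ^ 2 by norm_num, Real.log_pow]; norm_num]
    exact Real.log_le_log (by norm_num) (by norm_num)
  have hlogs : 0 ≤ Real.log s := Real.log_nonneg hs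
  have hD : 0 < D := by
    rcases Nat.eq_zero_or_pos D with rfl | h
    · simp only [Nat.cast_zero, zero_add, Real.log_one] at hLlog
      nlinarith
    · exact h
  have hDr : (1 : ℝ) ≤ D := by exact_mod_cast hD
  set r := Real.sqrt s with hr
  have hr1 : 1 ≤ r := Real.one_le_sqrt.2 hs
  have hrs : r ^ 2 = s := Real.sq_sqrt hs0.le
  -- Of order `1 / √s`, so that the edge penalty `l ^ 2 * (2 * s)` is the constant `1 / 2`.
  set l := 1 / (2 * r) with hl
  have hl0 : 0 < l := by positivity
  have hl2 : l ≤ 1 / 2 := by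
    rw [hl]
    exact one_div_le_one_div_of_le (by norm_num) (by linarith)
  have hls : l ^ 2 * (2 * s) = 1 / 2 := by
    rw [← hrs, hl]; field_simp
  have hlogD : Real.log (D + 1) - Real.log 2 ≤ Real.log D := by
    rw [← Real.log_div hD1.ne' (by norm_num)]
    exact Real.log_le_log (by positivity) (by linarith)
  have hloglD : Real.log (l * D) = Real.log D - Real.log 2 - Real.log s / 2 := by
    rw [Real.log_mul hl0.ne' (by linarith), hl, Real.log_div one_ne_zero (by positivity),
      Real.log_one, Real.log_mul (by norm_num) (by positivity), hr, Real.log_sqrt hs0.le]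
    ring
  -- The right side is at least `L log 2 + 1/2 - 3 log 2` and the left at most `9L/20`; as `9/20 <
  -- log 2`, this holds for `L > 10`.
  have hB : L / 5 * (1 + l) ^ 2 ≤ 1 + Real.log (l * D) - 1 / 2 := by
    have h1 : (1 + l) ^ 2 ≤ 9 / 4 := by nlinarith
    have h2 : L / 5 * (1 + l) ^ 2 ≤ L / 5 * (9 / 4) :=
      mul_le_mul_of_nonneg_left h1 (by linarith)
    nlinarith
  have hmain := card_mul_le_of_indepSet_card_le hreg hl0 hD
    (fun v => (mul_le_mul_of_nonneg_left (hedge v) (by positivity)).trans_eq hls)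
    (by linarith) hB ha
  have ha0 : 0 ≤ a := by simpa using ha ∅ (mem_indepSetsIn.2 (by simp))
  rw [div_mul_eq_mul_div, div_le_iff₀ hD1]
  nlinarith

end SimpleGraph

/-! ### Counting binary words through their supports. -/

open Finset in
/-- The number of `i`-sets meeting `S` in exactly `j` points. -/
lemma Finset.card_filter_card_inter {α : Type*} [Fintype α] [DecidableEq α] (S : Finset α)
    {i j : ℕ} (hj : j ≤ i) :
    #{T : Finset α | #T = i ∧ #(T ∩ S) = j} =
      (#S).choose j * (Fintype.card α - #S).choose (i - j) := by
  rw [← card_compl, ← card_powersetCard, ← card_powersetCard, ← card_product]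
  refine card_bij' (fun T _ => (T ∩ S, T \ S)) (fun P _ => P.1 ∪ P.2) ?_ ?_ ?_ ?_
  · intro T hT
    simp only [mem_filter, mem_univ, true_and] at hT
    simp only [mem_product, mem_powersetCard]
    refine ⟨⟨inter_subset_right, hT.2⟩, fun x hx => ?_, ?_⟩
    · simpa using (mem_sdiff.1 hx).2
    · have := card_sdiff_add_card_inter T S
      omega
  · rintro ⟨A, B⟩ hP
    simp only [mem_product, mem_powersetCard] at hP
    obtain ⟨⟨hA, hAj⟩, hB, hBj⟩ := hP
    have hBS : Disjoint B S := disjoint_left.2 fun x hx => by simpa using hB hx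
    have hAB : Disjoint A B := (hBS.mono_right hA).symm
    simp only [mem_filter, mem_univ, true_and]
    rw [card_union_of_disjoint hAB, union_inter_distrib_right, inter_eq_left.2 hA,
      disjoint_iff_inter_eq_empty.1 hBS, union_empty]
    omega
  · intro T _
    rw [union_comm, sdiff_union_inter]
  · rintro ⟨A, B⟩ hP
    simp only [mem_product, mem_powersetCard] at hP
    obtain ⟨⟨hA, hAj⟩, hB, hBj⟩ := hP
    have hBS : Disjoint B S := disjoint_left.2 fun x hx => by simpa using hB hx
    refine Prod.ext ?_ ?_
    · simp only
      rw [union_inter_distrib_right, inter_eq_left.2 hA, disjoint_iff_inter_eq_empty.1 hBS,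
        union_empty]
    · simp only
      rw [union_sdiff_distrib, sdiff_eq_empty_iff_subset.2 hA, empty_union,
        sdiff_eq_self_of_disjoint hBS]

open Finset in
/-- The number of nonempty sets of size at most `r` at distance at most `r` from `S`. -/
lemma Finset.card_filter_near {α : Type*} [Fintype α] [DecidableEq α] (S : Finset α) (r : ℕ) :
    #{T : Finset α | (1 ≤ #T ∧ #T ≤ r) ∧ #S + #T ≤ r + 2 * #(T ∩ S)} =
      ∑ i ∈ Icc 1 r, ∑ j ∈ Icc ⌈((#S : ℝ) + (i : ℝ) - (r : ℝ)) / 2⌉₊ (min #S i),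
        (#S).choose j * (Fintype.card α - #S).choose (i - j) := by
  rw [card_eq_sum_card_fiberwise (f := card) (t := Icc 1 r) (by
    intro T hT
    have := (mem_filter.1 (mem_coe.1 hT)).2.1
    exact mem_coe.2 (mem_Icc.2 this))]
  refine sum_congr rfl fun i hi => ?_
  -- The lower summation limit says exactly that the symmetric difference, of size `#S + i - 2 * j`,
  -- has at most `r` elements.
  have hceil : ∀ j : ℕ, ⌈((#S : ℝ) + (i : ℝ) - (r : ℝ)) / 2⌉₊ ≤ j ↔ #S + i ≤ r + 2 * j := by
    intro j
    rw [Nat.ceil_le, div_le_iff₀ (by norm_num), sub_le_iff_le_add,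
      show (j : ℝ) * 2 + r = ((r + 2 * j : ℕ) : ℝ) by push_cast; ring]
    exact_mod_cast Iff.rfl
  rw [card_eq_sum_card_fiberwise (f := fun T => #(T ∩ S))
    (t := Icc ⌈((#S : ℝ) + (i : ℝ) - (r : ℝ)) / 2⌉₊ (min #S i)) (by
    intro T hT
    simp only [coe_filter, mem_filter, mem_univ, true_and, Set.mem_ofPred_eq] at hT
    obtain ⟨⟨_, h⟩, rfl⟩ := hT
    exact mem_coe.2 (mem_Icc.2 ⟨(hceil _).2 h, le_min (card_le_card inter_subset_right)
      (card_le_card inter_subset_left)⟩))]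
  refine sum_congr rfl fun j hj => ?_
  rw [mem_Icc, hceil, le_min_iff] at hj
  rw [← card_filter_card_inter S hj.2.2]
  congr 1
  ext T
  simp only [mem_filter, mem_univ, true_and]
  rw [mem_Icc] at hi
  constructor
  · rintro ⟨⟨_, h1⟩, h2⟩
    exact ⟨h1, h2⟩
  · rintro ⟨rfl, rfl⟩
    exact ⟨⟨⟨hi, hj.1⟩, rfl⟩, rfl⟩

/-- Binary words of length `n` correspond to their supports. -/
def binaryWordSupport (n : ℕ) : (Fin n → ZMod 2) ≃ Finset (Fin n) where
  toFun u := {i | u i ≠ 0}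
  invFun S i := if i ∈ S then 1 else 0
  left_inv u := by
    have h : ∀ a : ZMod 2, (if a ≠ 0 then (1 : ZMod 2) else 0) = a := by decide
    funext i
    simpa using h (u i)
  right_inv S := by
    ext i
    simp

lemma card_binaryWordSupport {n : ℕ} (u : Fin n → ZMod 2) :
    (binaryWordSupport n u).card = hammingNorm u := rfl

lemma hammingDist_add_two_mul_card_inter {n : ℕ} (u v : Fin n → ZMod 2) :
    hammingDist u v + 2 * (binaryWordSupport n v ∩ binaryWordSupport n u).card =
      hammingNorm u + hammingNorm v := by
  rw [← card_binaryWordSupport, ← card_binaryWordSupport]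
  set S := binaryWordSupport n u with hS
  set T := binaryWordSupport n v with hT
  have h : hammingDist u v = ((S \ T) ∪ (T \ S)).card := by
    rw [hammingDist]
    congr 1
    ext i
    have h2 : ∀ a b : ZMod 2, a ≠ b ↔ (a ≠ 0 ∧ ¬ b ≠ 0) ∨ (b ≠ 0 ∧ ¬ a ≠ 0) := by decide
    simpa [hS, hT, binaryWordSupport] using h2 (u i) (v i)
  rw [h, Finset.card_union_of_disjoint
    (Finset.disjoint_left.2 fun x hx hx' => (Finset.mem_sdiff.1 hx).2 (Finset.mem_sdiff.1 hx').1)]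
  have h1 := Finset.card_sdiff_add_card_inter S T
  have h2 := Finset.card_sdiff_add_card_inter T S
  rw [Finset.inter_comm] at h1
  omega

lemma card_hammingNorm_eq (n w : ℕ) :
    (Finset.univ.filter fun u : Fin n → ZMod 2 => hammingNorm u = w).card = n.choose w := by
  have h := Finset.card_powersetCard w (Finset.univ : Finset (Fin n))
  rw [Finset.card_univ, Fintype.card_fin] at h
  rw [← h]
  refine Finset.card_bijective _ (binaryWordSupport n).bijective fun u => ?_
  simp [Finset.mem_powersetCard, card_binaryWordSupport]

lemma card_hammingNorm_hammingDist_le {n r : ℕ} (u : Fin n → ZMod 2) :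
    (Finset.univ.filter fun v : Fin n → ZMod 2 =>
      (1 ≤ hammingNorm v ∧ hammingNorm v ≤ r) ∧ hammingDist u v ≤ r).card =
    ∑ i ∈ Finset.Icc 1 r, ∑ j ∈ Finset.Icc
      ⌈((hammingNorm u : ℝ) + (i : ℝ) - (r : ℝ)) / 2⌉₊ (min (hammingNorm u) i),
        (hammingNorm u).choose j * (n - hammingNorm u).choose (i - j) := by
  have h := Finset.card_filter_near (binaryWordSupport n u) r
  rw [card_binaryWordSupport, Fintype.card_fin] at h
  rw [← h]
  refine Finset.card_bijective _ (binaryWordSupport n).bijective fun v => ?_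
  have := hammingDist_add_two_mul_card_inter u v
  simp only [Finset.mem_filter, Finset.mem_univ, true_and, card_binaryWordSupport]
  refine and_congr_right fun _ => ?_
  omega

/-! ### Regularity and local edge counts of the Gilbert graph. -/

instance (n d : ℕ) : DecidableRel (gilbertGraph n d).Adj := fun u v =>
  inferInstanceAs (Decidable (1 ≤ hammingDist u v ∧ hammingDist u v ≤ d - 1))

namespace gilbertGraph

variable {n d : ℕ}

lemma adj_iff {u v : Fin n → ZMod 2} :
    (gilbertGraph n d).Adj u v ↔ 1 ≤ hammingDist u v ∧ hammingDist u v ≤ d - 1 := Iff.rfl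

/-- Translations are automorphisms, so degrees and neighbourhood edge counts need only be computed
at the zero word. -/
lemma adj_add_left (a u v : Fin n → ZMod 2) :
    (gilbertGraph n d).Adj (a + u) (a + v) ↔ (gilbertGraph n d).Adj u v := by
  have : hammingDist (a + u) (a + v) = hammingDist u v := by
    simp [hammingDist]
  rw [adj_iff, adj_iff, this]

lemma neighborFinset_zero : (gilbertGraph n d).neighborFinset 0 =
    Finset.univ.filter fun v => 1 ≤ hammingNorm v ∧ hammingNorm v ≤ d - 1 := by
  ext v
  simp [adj_iff, hammingDist_zero_left]

lemma neighborFinset_eq_map (a : Fin n → ZMod 2) : (gilbertGraph n d).neighborFinset a =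
    ((gilbertGraph n d).neighborFinset 0).map (addLeftEmbedding a) := by
  ext v
  simp only [SimpleGraph.mem_neighborFinset, Finset.mem_map, addLeftEmbedding_apply]
  constructor
  · intro h
    refine ⟨-a + v, ?_, by simp⟩
    rw [← adj_add_left a]
    simpa using h
  · rintro ⟨w, hw, rfl⟩
    rw [← adj_add_left a] at hw
    simpa using hw

lemma isRegularOfDegree : (gilbertGraph n d).IsRegularOfDegree
    ((gilbertGraph n d).neighborFinset 0).card := fun a => by
  rw [← SimpleGraph.card_neighborFinset_eq_degree, neighborFinset_eq_map, Finset.card_map]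

lemma card_neighborFinset_zero_add_one :
    ((gilbertGraph n d).neighborFinset 0).card + 1 = hammingVolume n (d - 1) := by
  -- The zero word is the `+ 1`; index `i` of the shifted sum stands for weight `i + 1`.
  rw [hammingVolume, Finset.sum_range_succ', Nat.choose_zero_right, neighborFinset_zero,
    Finset.card_eq_sum_card_fiberwise (f := fun v => hammingNorm v - 1)
      (t := Finset.range (d - 1))]
  · congr 1
    refine Finset.sum_congr rfl fun i hi => ?_
    rw [← card_hammingNorm_eq]
    congr 1
    ext v
    rw [Finset.mem_range] at hi
    simp only [Finset.mem_filter, Finset.mem_univ, true_and]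
    omega
  · intro v hv
    simp only [Finset.coe_filter, Finset.mem_univ, true_and, Set.mem_ofPred_eq] at hv
    simp only [Finset.coe_range, Set.mem_Iio]
    omega

lemma sum_card_filter_adj_eq (a : Fin n → ZMod 2) :
    ∑ u ∈ (gilbertGraph n d).neighborFinset a,
      (((gilbertGraph n d).neighborFinset a).filter ((gilbertGraph n d).Adj u)).card =
    ∑ u ∈ (gilbertGraph n d).neighborFinset 0,
      (((gilbertGraph n d).neighborFinset 0).filter ((gilbertGraph n d).Adj u)).card := by
  rw [neighborFinset_eq_map a, Finset.sum_map]
  refine Finset.sum_congr rfl fun u _ => ?_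
  rw [Finset.filter_map, Finset.card_map]
  congr 1
  refine Finset.filter_congr fun v _ => ?_
  simp [adj_add_left]

lemma sum_card_filter_adj_zero_eq_edges :
    ∑ u ∈ (gilbertGraph n d).neighborFinset 0,
      (((gilbertGraph n d).neighborFinset 0).filter ((gilbertGraph n d).Adj u)).card =
    2 * (sphereGraph n d).edgeSet.ncard := by
  classical
  let _ : Fintype {u // u ∈ (gilbertGraph n d).neighborSet 0} := Subtype.fintype _
  rw [Set.ncard_eq_toFinset_card']
  change _ = 2 * (sphereGraph n d).edgeFinset.card
  rw [← SimpleGraph.sum_degrees_eq_twice_card_edges,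
    Finset.sum_subtype ((gilbertGraph n d).neighborFinset 0)
      (p := (· ∈ (gilbertGraph n d).neighborSet 0)) (by simp)]
  refine Finset.sum_congr rfl fun u _ => ?_
  rw [← SimpleGraph.card_neighborFinset_eq_degree,
    ← Finset.card_map (Function.Embedding.subtype (· ∈ (gilbertGraph n d).neighborSet 0))]
  congr 1
  ext v
  simp only [Finset.mem_filter, SimpleGraph.mem_neighborFinset, Finset.mem_map,
    Function.Embedding.subtype_apply]
  exact ⟨fun h => ⟨⟨v, h.1⟩, h.2, rfl⟩, fun ⟨w, hw, hv⟩ => hv ▸ ⟨w.2, hw⟩⟩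

/-- The degree of a vertex in the sphere graph depends only on its weight. The degree sum counts
each edge twice, and `e` is a third of the edge count, whence the factor 6. -/
lemma sum_card_filter_adj_zero_eq_sphereEdgeThird :
    ((∑ u ∈ (gilbertGraph n d).neighborFinset 0,
      (((gilbertGraph n d).neighborFinset 0).filter ((gilbertGraph n d).Adj u)).card : ℕ) : ℝ) =
    6 * sphereEdgeThird n (d - 1) := by
  set r := d - 1 with hr
  set f : ℕ → ℝ := fun w => (∑ i ∈ Finset.Icc 1 r,
        ∑ j ∈ Finset.Icc ⌈((w : ℝ) + (i : ℝ) - (r : ℝ)) / 2⌉₊ (min w i),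
          (w.choose j : ℝ) * ((n - w).choose (i - j) : ℝ)) - 1 with hf
  have h1 : ∀ u ∈ (gilbertGraph n d).neighborFinset 0,
      ((((gilbertGraph n d).neighborFinset 0).filter ((gilbertGraph n d).Adj u)).card : ℝ) =
        f (hammingNorm u) := by
    intro u hu
    have hu' : 1 ≤ hammingNorm u ∧ hammingNorm u ≤ r := by
      simpa [neighborFinset_zero] using hu
    have h2 := card_hammingNorm_hammingDist_le (r := r) u
    -- The count of near words includes `u` itself, which accounts for the `- 1` in `f`.
    have h3 : (Finset.univ.filter fun v : Fin n → ZMod 2 =>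
        (1 ≤ hammingNorm v ∧ hammingNorm v ≤ r) ∧ hammingDist u v ≤ r) =
        insert u (((gilbertGraph n d).neighborFinset 0).filter ((gilbertGraph n d).Adj u)) := by
      ext v
      simp only [neighborFinset_zero, Finset.mem_insert, Finset.mem_filter, Finset.mem_univ,
        true_and, adj_iff, ← hr]
      by_cases huv : v = u
      · subst huv
        simp [hu']
      · have : 1 ≤ hammingDist u v := hammingDist_pos.2 (Ne.symm huv)
        tauto
    rw [h3, Finset.card_insert_of_notMem (by simp)] at h2
    have h4 := congrArg (Nat.cast : ℕ → ℝ) h2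
    push_cast at h4
    simp only [hf]
    linarith
  have hmap : ∀ u ∈ (gilbertGraph n d).neighborFinset 0, hammingNorm u ∈ Finset.Icc 1 r := by
    intro u hu
    simpa [neighborFinset_zero] using hu
  rw [Nat.cast_sum, Finset.sum_congr rfl h1, ← Finset.sum_fiberwise_of_maps_to hmap,
    sphereEdgeThird, ← mul_assoc, show (6 : ℝ) * (1 / 6) = 1 by norm_num, one_mul]
  refine Finset.sum_congr rfl fun w hw => ?_
  rw [Finset.sum_congr rfl (g := fun _ => f w) fun u hu => by rw [(Finset.mem_filter.1 hu).2],
    Finset.sum_const, nsmul_eq_mul, ← card_hammingNorm_eq]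
  congr 3
  ext u
  simp only [neighborFinset_zero, Finset.mem_filter, Finset.mem_univ, true_and]
  rw [Finset.mem_Icc] at hw
  omega

end gilbertGraph

/-! ### From independent sets to codes. -/

lemma card_le_A₂ {n d : ℕ} {C : Finset (Fin n → ZMod 2)} (hC : IsBinaryCode n d C) :
    C.card ≤ A₂ n d := by
  refine le_csSup ⟨Fintype.card (Fin n → ZMod 2), ?_⟩ ⟨C, hC, rfl⟩
  rintro m ⟨C', _, rfl⟩
  exact Finset.card_le_univ _

theorem mainTheorem2 (n d : ℕ) (hd : 1 ≤ d) (hdn : d ≤ n) :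
    sphereEdgeThird n (d - 1) = ((sphereGraph n d).edgeSet.ncard : ℝ) / 3 ∧
    (2 : ℝ) ^ n / (hammingVolume n (d - 1) : ℝ) *
        ((Real.logb 2 (hammingVolume n (d - 1) : ℝ) -
          Real.logb 2 (Real.sqrt (sphereEdgeThird n (d - 1)))) / 10)
      ≤ (A₂ n d : ℝ) := by
  have hE := gilbertGraph.sum_card_filter_adj_zero_eq_sphereEdgeThird (n := n) (d := d)
  rw [gilbertGraph.sum_card_filter_adj_zero_eq_edges] at hE
  push_cast at hE
  set t := (sphereGraph n d).edgeSet.ncard with ht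
  have he : sphereEdgeThird n (d - 1) = (t : ℝ) / 3 := by linarith
  refine ⟨he, ?_⟩
  have ha : ∀ I ∈ (gilbertGraph n d).indepSetsIn Finset.univ, (I.card : ℝ) ≤ (A₂ n d : ℝ) := by
    intro I hI
    refine Nat.cast_le.2 (card_le_A₂ fun u hu v hv huv => ?_)
    have h1 := (SimpleGraph.mem_indepSetsIn.1 hI).2 u hu v hv
    have h2 : 1 ≤ hammingDist u v := hammingDist_pos.2 huv
    rw [gilbertGraph.adj_iff] at h1
    omega
  -- The maximum with 1 meets the requirement `1 ≤ s` when the sphere graph has no edges.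
  have hedge : ∀ v, ∑ u ∈ (gilbertGraph n d).neighborFinset v,
      ((((gilbertGraph n d).neighborFinset v).filter ((gilbertGraph n d).Adj u)).card : ℝ) ≤
      2 * max (t : ℝ) 1 := by
    intro v
    have h := gilbertGraph.sum_card_filter_adj_eq (d := d) v
    rw [gilbertGraph.sum_card_filter_adj_zero_eq_edges] at h
    have h' := congrArg (Nat.cast : ℕ → ℝ) h
    push_cast at h'
    rw [h']
    linarith [le_max_left (t : ℝ) 1]
  have hmain := SimpleGraph.mul_logb_le_of_indepSet_card_le gilbertGraph.isRegularOfDegree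
    (le_max_right _ _) hedge ha
  have hV : (((gilbertGraph n d).neighborFinset 0).card : ℝ) + 1 = hammingVolume n (d - 1) := by
    exact_mod_cast gilbertGraph.card_neighborFinset_zero_add_one
  have hN : (Fintype.card (Fin n → ZMod 2) : ℝ) = 2 ^ n := by simp [ZMod.card]
  rw [hV, hN] at hmain
  refine le_trans (mul_le_mul_of_nonneg_left ?_ (by positivity)) hmain
  rw [he]
  -- For `t = 0` the right side is `Real.logb 2 0 = 0`, the convention of the theorem, and the left
  -- side is nonpositive.
  have hlog : Real.logb 2 (Real.sqrt (max (t : ℝ) 1 / 3)) ≤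
      Real.logb 2 (Real.sqrt ((t : ℝ) / 3)) := by
    rcases Nat.eq_zero_or_pos t with h0 | h0
    · have : Real.sqrt (1 / 3) ≤ 1 := Real.sqrt_le_one.2 (by norm_num)
      simpa [h0] using Real.logb_nonpos (by norm_num : (1 : ℝ) < 2) (Real.sqrt_nonneg _) this
    · rw [max_eq_left (by exact_mod_cast h0)]
  linarith
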